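/- Let $A$ be a finite set of nonnegative integers. Say that $A$ tiles the integers if there is a set $C\subseteq\mathbb{Z}$ such that every integer can be written in exactly one way as $a+c$ with $a\in A$ and $c\in C$. Put $A(x)=\sum_{a\in A}x^a$, let $\Phi_s(x)$ denote the $s$-th cyclotomic polynomial, and let $S_A$ be the set of prime powers $s=p^k$ ($p$ prime, $k\ge 1$) such that $\Phi_s(x)$ divides $A(x)$ in $\mathbb{Z}[x]$. Theorem B2. Suppose that $A$ tiles the integers and that the cardinality $\#A$ has at most two distinct prime factors. Then $A(x)$ satisfies the condition (T2) whenever $m\ge 1$ and $s_1,\dots,s_m\in S_A$ are powers of $m$ distinct primes, the polynomial $\Phi_{s_1\cdots s_m}(x)$ divides $A(x)$. -/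

import Mathlib

/-- A finite set `A` of nonnegative integers tiles the integers: for some set `C` of integers,
every integer is uniquely `a + c` with `a ∈ A` and `c ∈ C`, i.e. `A ⊕ C = ℤ`. -/
def TilesIntegers (A : Finset ℕ) : Prop :=
  ∃ C : Set ℤ, AddSubgroup.IsComplement ((fun a : ℕ => (a : ℤ)) '' (A : Set ℕ)) C

/-- The polynomial `A(x) = ∑_{a ∈ A} x ^ a`. -/
noncomputable def setPoly (A : Finset ℕ) : Polynomial ℤ :=
  ∑ a ∈ A, (Polynomial.X : Polynomial ℤ) ^ a

/-- The set `S_A` of prime powers `s = p ^ k`, `k ≥ 1`, such that `Φ_s(x)` divides `A(x)`. -/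
def primePowerDivisors (A : Finset ℕ) : Set ℕ :=
  {s | IsPrimePow s ∧ Polynomial.cyclotomic s ℤ ∣ setPoly A}

/-- Condition (T2): whenever `s_1, …, s_m ∈ S_A` (`m ≥ 1`) are powers of distinct primes
`p_1, …, p_m`, the polynomial `Φ_{s_1 ⋯ s_m}(x)` divides `A(x)`. -/
def SatisfiesT2 (A : Finset ℕ) : Prop :=
  ∀ m : ℕ, 1 ≤ m → ∀ s : Fin m → ℕ, (∀ i, s i ∈ primePowerDivisors A) →
    (∃ p : Fin m → ℕ, Function.Injective p ∧ ∀ i, (p i).Prime ∧ ∃ k : ℕ, s i = p i ^ k) →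
    Polynomial.cyclotomic (∏ i, s i) ℤ ∣ setPoly A

/-! A tiling of the integers by a finite set yields a tiling `A ⊕ B = ℤ / n`. Multiplying `A` by a
prime `r` not dividing `#A` preserves the tiling (`TilesMod.image_mul_prime`), and this has two
uses. It lets every prime not dividing `#A` be stripped from `n`, leaving at most two primes `p`,
`q`. It also forces one of the tiles into a single class modulo `p` or `q` (`TilesMod.dvd_sub`):
otherwise both tiles have differences that are units, and a suitable multiple makes two sums
collide.

Divisibility by `Φ_s` means that the exponential sum vanishes at primitive `s`-th roots of unity.
The confined tile allows induction on `n`. If it is `A`, then `A` is an affine copy of a smaller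
tile; if it is `B`, then `A` splits into residue fibres, each tiling with the same smaller
complement. In the second case a count of prime powers (`not_vanishesAt_and_dvd`) passes the
vanishing of `A` to every fibre. -/

/-- `A ⊕ B = ℤ / n`: every residue class modulo `n` is `a + b` for exactly one pair
`(a, b) ∈ A × B`. -/
structure TilesMod (n : ℕ) (A B : Finset ℤ) : Prop where
  exists_modEq : ∀ x : ℤ, ∃ a ∈ A, ∃ b ∈ B, a + b ≡ x [ZMOD n]
  eq_of_modEq : ∀ a ∈ A, ∀ a' ∈ A, ∀ b ∈ B, ∀ b' ∈ B, a + b ≡ a' + b' [ZMOD n] → a = a' ∧ b = b'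

/-- The quotients `(a - j) / r` of the elements `a ∈ A` with `a ≡ j` modulo `r`. -/
def residueFiber (A : Finset ℤ) (r : ℕ) (j : ℤ) : Finset ℤ :=
  {a ∈ A | a % r = j}.image (· / (r : ℤ))

theorem mem_residueFiber {A : Finset ℤ} {r : ℕ} (hr : 0 < r) {j : ℤ} (hj : 0 ≤ j) (hjr : j < r)
    {x : ℤ} : x ∈ residueFiber A r j ↔ r * x + j ∈ A := by
  have hr' : (r : ℤ) ≠ 0 := by positivity
  simp only [residueFiber, Finset.mem_image, Finset.mem_filter]
  constructor
  · rintro ⟨a, ⟨ha, h⟩, rfl⟩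
    rwa [← h, Int.mul_ediv_add_emod]
  · intro h
    refine ⟨_, ⟨h, ?_⟩, ?_⟩
    · rw [Int.mul_add_emod_self_left, Int.emod_eq_of_lt hj hjr]
    · rw [Int.mul_add_ediv_left _ _ hr', Int.ediv_eq_zero_of_lt hj hjr, add_zero]

/-! ### Tilings of `ℤ / n` and multiples of a tile. -/

namespace TilesMod

variable {n : ℕ} {A B : Finset ℤ}

theorem symm (h : TilesMod n A B) : TilesMod n B A where
  exists_modEq x := by
    obtain ⟨a, ha, b, hb, e⟩ := h.exists_modEq x
    exact ⟨b, hb, a, ha, by rwa [add_comm]⟩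
  eq_of_modEq b hb b' hb' a ha a' ha' e :=
    (h.eq_of_modEq a ha a' ha' b hb b' hb' (by rwa [add_comm a, add_comm a'])).symm

theorem bijOn (h : TilesMod n A B) :
    Set.BijOn (fun x : ℤ × ℤ => ((x.1 + x.2 : ℤ) : ZMod n)) (A ×ˢ B : Finset (ℤ × ℤ)) Set.univ := by
  refine ⟨Set.mapsTo_univ _ _, ?_, ?_⟩
  · rintro ⟨a, b⟩ hab ⟨a', b'⟩ hab' e
    simp only [Finset.coe_product, Set.mem_prod, Finset.mem_coe] at hab hab'
    obtain ⟨rfl, rfl⟩ := h.eq_of_modEq a hab.1 a' hab'.1 b hab.2 b' hab'.2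
      ((ZMod.intCast_eq_intCast_iff _ _ _).1 e)
    rfl
  · intro x _
    obtain ⟨y, rfl⟩ := ZMod.intCast_surjective x
    obtain ⟨a, ha, b, hb, e⟩ := h.exists_modEq y
    exact ⟨(a, b), by simp [ha, hb], (ZMod.intCast_eq_intCast_iff _ _ _).2 e⟩

theorem sum_eq [NeZero n] {M : Type*} [AddCommMonoid M] (h : TilesMod n A B) (f : ZMod n → M) :
    ∑ x ∈ A ×ˢ B, f ((x.1 + x.2 : ℤ) : ZMod n) = ∑ y, f y :=
  Finset.sum_bij (fun x _ => ((x.1 + x.2 : ℤ) : ZMod n)) (fun _ _ => Finset.mem_univ _)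
    (fun _ hx _ hy e => h.bijOn.injOn hx hy e)
    (fun y _ => by
      obtain ⟨x, hx, e⟩ := h.bijOn.surjOn (Set.mem_univ y)
      exact ⟨x, hx, e⟩)
    (fun _ _ => rfl)

theorem card_mul_card [NeZero n] (h : TilesMod n A B) : A.card * B.card = n := by
  simpa [ZMod.card] using h.sum_eq (fun _ => (1 : ℕ))

theorem of_card_of_exists [NeZero n] (hc : A.card * B.card = n)
    (h : ∀ x : ℤ, ∃ a ∈ A, ∃ b ∈ B, a + b ≡ x [ZMOD n]) : TilesMod n A B := by
  refine ⟨h, fun a ha a' ha' b hb b' hb' e => ?_⟩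
  have key := Finset.injOn_of_surjOn_of_card_le (s := A ×ˢ B) (t := (Finset.univ : Finset (ZMod n)))
    (fun x : ℤ × ℤ => ((x.1 + x.2 : ℤ) : ZMod n)) (fun _ _ => by simp) (fun x _ => by
      obtain ⟨y, rfl⟩ := ZMod.intCast_surjective x
      obtain ⟨a, ha, b, hb, e⟩ := h y
      exact ⟨(a, b), by simp [ha, hb], (ZMod.intCast_eq_intCast_iff _ _ _).2 e⟩)
    (by simp [hc])
  have := @key (a, b) (by simp [ha, hb]) (a', b') (by simp [ha', hb'])
    ((ZMod.intCast_eq_intCast_iff _ _ _).2 e)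
  exact Prod.ext_iff.1 this

/-- In the group algebra of `ℤ / n` over `𝔽_r`, the tiling reads `α β = J`, with `J` the sum of all
group elements. Then `α ^ r β = #A ^ (r - 1) J = J` by Fermat, while Frobenius turns `α ^ r` into
the element of `r A`. All coefficients of `J` are nonzero, so `r A + B` covers `ℤ / n`, and counting
gives uniqueness. -/
theorem image_mul_prime [NeZero n] (h : TilesMod n A B) {r : ℕ} (hr : r.Prime)
    (hrA : ¬ r ∣ A.card) : TilesMod n (A.image ((r : ℤ) * ·)) B := by
  have hr0 : (r : ℤ) ≠ 0 := by exact_mod_cast hr.ne_zero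
  refine of_card_of_exists ?_ fun x => ?_
  · rw [Finset.card_image_of_injective _ (mul_right_injective₀ hr0), h.card_mul_card]
  have := Fact.mk hr
  have : ExpChar (AddMonoidAlgebra (ZMod r) (ZMod n)) r :=
    expChar_of_injective_ringHom (f := AddMonoidAlgebra.singleZeroRingHom (R := ZMod r)
      (M := ZMod n)) (AddMonoidAlgebra.single_right_injective) r
  let e : ZMod n → (AddMonoidAlgebra (ZMod r) (ZMod n)) := fun g => AddMonoidAlgebra.single g 1
  have he : ∀ g g', e g * e g' = e (g + g') := fun g g' => by
    simp [e, AddMonoidAlgebra.single_mul_single]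
  let α : (AddMonoidAlgebra (ZMod r) (ZMod n)) := ∑ a ∈ A, e a
  let β : (AddMonoidAlgebra (ZMod r) (ZMod n)) := ∑ b ∈ B, e b
  let J : (AddMonoidAlgebra (ZMod r) (ZMod n)) := ∑ g, e g
  have hJ : α * β = J := by
    simp only [α, β, J]
    rw [← h.sum_eq e, Finset.sum_product, Finset.sum_mul_sum]
    simp [he]
  have hα : ∀ k : ℕ, α ^ k * J = (A.card : (AddMonoidAlgebra (ZMod r) (ZMod n))) ^ k * J := by
    have h1 : α * J = (A.card : (AddMonoidAlgebra (ZMod r) (ZMod n))) * J := by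
      have : ∀ a : ZMod n, e a * J = J := fun a => by
        simp only [J, Finset.mul_sum, he]
        exact Fintype.sum_equiv (Equiv.addLeft a) _ _ fun _ => rfl
      simp [α, Finset.sum_mul, this]
    intro k
    induction k with
    | zero => simp
    | succ k ih => rw [pow_succ, mul_assoc, h1, mul_left_comm, ih, pow_succ]; ring
  have hfermat : (A.card : (AddMonoidAlgebra (ZMod r) (ZMod n))) ^ (r - 1) = 1 := by
    have h0 : ((A.card : ℕ) : ZMod r) ≠ 0 := by rwa [Ne, ZMod.natCast_eq_zero_iff]
    have := congrArg (AddMonoidAlgebra.singleZeroRingHom (R := ZMod r) (M := ZMod n))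
      (ZMod.pow_card_sub_one_eq_one h0)
    simpa only [map_pow, map_natCast, map_one] using this
  have hpow : α ^ r * β = J := by
    obtain ⟨k, hk⟩ : ∃ k, r = k + 1 := ⟨r - 1, by have := hr.pos; omega⟩
    have : k = r - 1 := by omega
    have hs : α ^ r = α ^ (r - 1) * α := by rw [← pow_succ, ← this, ← hk]
    rw [hs, mul_assoc, hJ, hα, hfermat, one_mul]
  have hfrob : α ^ r = ∑ a ∈ A, e ((r * a : ℤ) : ZMod n) := by
    rw [sum_pow_char]
    refine Finset.sum_congr rfl fun a _ => ?_
    simp [e, AddMonoidAlgebra.single_pow]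
  by_contra! hx
  have hcoeff := congrArg (fun f : (AddMonoidAlgebra (ZMod r) (ZMod n)) => f.coeff (x : ZMod n)) hpow
  simp only [hfrob, β, J, Finset.sum_mul_sum, he, AddMonoidAlgebra.coeff_sum, e,
    Finsupp.finsetSum_apply, AddMonoidAlgebra.coeff_single] at hcoeff
  rw [Finset.sum_eq_zero] at hcoeff
  · simp [Finsupp.single_apply] at hcoeff
  · intro a ha
    refine Finset.sum_eq_zero fun b hb => ?_
    rw [Finsupp.single_eq_of_ne]
    intro h'
    refine hx _ (Finset.mem_image_of_mem _ ha) b hb ?_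
    rw [← ZMod.intCast_eq_intCast_iff, h']
    push_cast
    rfl

theorem image_mul [NeZero n] (h : TilesMod n A B) {r : ℕ} (hr : r ≠ 0)
    (hrA : r.Coprime A.card) : TilesMod n (A.image ((r : ℤ) * ·)) B := by
  induction r using induction_on_primes with
  | zero => exact absurd rfl hr
  | one => simpa using h
  | prime_mul p a hp ih =>
    have ha : a ≠ 0 := right_ne_zero_of_mul hr
    have h1 := ih ha hrA.coprime_mul_left
    have h2 := h1.image_mul_prime hp (by
      rw [Finset.card_image_of_injective _
        (mul_right_injective₀ (by exact_mod_cast ha : (a : ℤ) ≠ 0)), ← hp.coprime_iff_not_dvd]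
      exact hrA.coprime_mul_right)
    rw [Finset.image_image] at h2
    convert h2 using 2
    funext x
    simp [mul_assoc]

/-- Since `B` occupies one class modulo `r`, the class of `a + b` determines that of `a`, so the
fibres of `A` tile separately. -/
theorem residueFiber {r m : ℕ} {k : ℤ} (h : TilesMod (r * m) A B) (hr : 0 < r)
    (hB : ∀ b ∈ B, b % r = k) {j : ℤ} (hj : 0 ≤ j) (hjr : j < r) :
    TilesMod m (residueFiber A r j) (residueFiber B r k) := by
  have hr' : (0 : ℤ) < r := by exact_mod_cast hr
  obtain ⟨-, -, b₀, hb₀, -⟩ := h.exists_modEq 0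
  have hk : 0 ≤ k := hB _ hb₀ ▸ Int.emod_nonneg _ hr'.ne'
  have hkr : k < r := hB _ hb₀ ▸ Int.emod_lt_of_pos _ hr'
  constructor
  · intro x
    obtain ⟨a, ha, b, hb, e⟩ := h.exists_modEq (r * x + (j + k))
    push_cast at e
    have hbk := hB b hb
    have hb' : b = r * (b / r) + k := by rw [← hbk, Int.mul_ediv_add_emod]
    have haj : a % r = j := by
      have e1 : a + b ≡ r * x + (j + k) [ZMOD r] := e.of_mul_right _
      have e2 : a ≡ j [ZMOD r] := by
        refine Int.ModEq.add_right_cancel' b (e1.trans ?_)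
        rw [Int.modEq_iff_dvd, hb']
        exact ⟨b / r - x, by ring⟩
      rw [e2, Int.emod_eq_of_lt hj hjr]
    have ha' : a = r * (a / r) + j := by rw [← haj, Int.mul_ediv_add_emod]
    refine ⟨a / r, (mem_residueFiber hr hj hjr).2 (ha' ▸ ha), b / r,
      (mem_residueFiber hr hk hkr).2 (hb' ▸ hb), ?_⟩
    refine Int.ModEq.mul_left_cancel' hr'.ne' (Int.ModEq.add_right_cancel' (j + k) ?_)
    convert e using 1
    nth_rw 2 [ha', hb']
    ring
  · intro a ha a' ha' b hb b' hb' e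
    rw [mem_residueFiber hr hj hjr] at ha ha'
    rw [mem_residueFiber hr hk hkr] at hb hb'
    have := h.eq_of_modEq _ ha _ ha' _ hb _ hb' (by
      have := (Int.ModEq.mul_left' (c := (r : ℤ)) e).add_right (j + k)
      push_cast
      convert this using 1 <;> ring)
    simpa [hr.ne'] using this

/-- A prime factor of the period not dividing the size of `A` can be removed. -/
theorem exists_of_not_dvd_card {r m : ℕ} [NeZero (r * m)] (h : TilesMod (r * m) A B)
    (hr : r.Prime) (hrA : ¬ r ∣ A.card) : ∃ B', TilesMod m A B' := by
  -- The tile `r A` lies in the class `0` modulo `r`, and its fibre there is `A` itself.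
  have h1 := (h.image_mul_prime hr hrA).symm.residueFiber hr.pos (k := 0) (j := 0)
    (by simp) le_rfl (by exact_mod_cast hr.pos)
  refine ⟨_root_.residueFiber B r 0, ?_⟩
  convert h1.symm using 1
  ext x
  rw [mem_residueFiber hr.pos le_rfl (by exact_mod_cast hr.pos)]
  simp [hr.ne_zero]

theorem exists_primeFactors_subset (h : TilesMod n A B) (hn : n ≠ 0) :
    ∃ m : ℕ, m ≠ 0 ∧ m.primeFactors ⊆ A.card.primeFactors ∧ ∃ B', TilesMod m A B' := by
  induction n using Nat.strong_induction_on generalizing B with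
  | _ n ih =>
    have := NeZero.mk hn
    by_cases hs : n.primeFactors ⊆ A.card.primeFactors
    · exact ⟨n, hn, hs, B, h⟩
    · obtain ⟨r, hr, hrA⟩ := Finset.not_subset.1 hs
      have hA : A.card ≠ 0 := fun h0 => hn (by rw [← h.card_mul_card, h0, zero_mul])
      have hrp := Nat.prime_of_mem_primeFactors hr
      obtain ⟨m, rfl⟩ := Nat.dvd_of_mem_primeFactors hr
      have hm : m ≠ 0 := right_ne_zero_of_mul hn
      obtain ⟨B', hB'⟩ := h.exists_of_not_dvd_card hrp
        fun hd => hrA (Nat.mem_primeFactors.2 ⟨hrp, hd, hA⟩)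
      exact ih m (lt_mul_of_one_lt_left (Nat.pos_of_ne_zero hm) hrp.one_lt) hB' hm

/-- Two tiles of `ℤ / n` cannot both have a difference coprime to `n`, unless `n = 1`. -/
theorem not_isUnit_sub [NeZero n] (h : TilesMod n A B) {a a' b b' : ℤ} (ha : a ∈ A) (ha' : a' ∈ A)
    (hb : b ∈ B) (hb' : b' ∈ B) (hne : a ≠ a') (hua : IsUnit ((a - a' : ℤ) : ZMod n))
    (hub : IsUnit ((b - b' : ℤ) : ZMod n)) : False := by
  obtain ⟨u, hu⟩ := hua
  obtain ⟨v, hv⟩ := hub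
  set w := v * u⁻¹
  have hcop : ((w : ZMod n).val + n).Coprime n := by
    simpa using ZMod.val_coe_unit_coprime w
  -- The multiplier satisfies `r (a - a') ≡ b - b'`, so `r a + b' ≡ r a' + b`. Adding `n` keeps it
  -- nonzero even when `n = 1`.
  set r := (w : ZMod n).val + n
  have hr : r ≠ 0 := by have := NeZero.ne n; omega
  have hrw : (r : ZMod n) = w := by simp [r]
  have h1 := h.image_mul hr (hcop.coprime_dvd_right ⟨_, h.card_mul_card.symm⟩)
  have := (h1.eq_of_modEq _ (Finset.mem_image_of_mem _ ha) _ (Finset.mem_image_of_mem _ ha')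
    b' hb' b hb ?_).1
  · exact hne (by simpa [hr] using this)
  · rw [← ZMod.intCast_eq_intCast_iff]
    have : (r : ZMod n) * (a - a' : ℤ) = (b - b' : ℤ) := by
      rw [← hu, ← hv, hrw, ← Units.val_mul]
      simp [w]
    push_cast at this ⊢
    linear_combination this

end TilesMod

/-! ### Confining one tile to a residue class. -/

/-- Two equivalence relations whose union relates all pairs cannot both be proper, just as a group
is not the union of two proper subgroups. -/
theorem Int.exists_pair_not_dvd_sub {A : Finset ℤ} {p q : ℤ}
    (hp : ∃ a ∈ A, ∃ a' ∈ A, ¬ p ∣ a - a') (hq : ∃ a ∈ A, ∃ a' ∈ A, ¬ q ∣ a - a') :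
    ∃ a ∈ A, ∃ a' ∈ A, ¬ p ∣ a - a' ∧ ¬ q ∣ a - a' := by
  by_contra! hcon
  obtain ⟨a, ha, a', ha', h1⟩ := hp
  obtain ⟨c, hc, c', hc', h2⟩ := hq
  have hne : ∀ x ∈ A, ∀ y ∈ A, p ∣ x - y ∨ q ∣ x - y := fun x hx y hy => by
    by_cases h : p ∣ x - y
    · exact Or.inl h
    · exact Or.inr (hcon x hx y hy h)
  have hq' : q ∣ a - a' := hcon a ha a' ha' h1
  have hp' : p ∣ c - c' := (hne c hc c' hc').resolve_right h2
  obtain ⟨d, hd, hd'⟩ : ∃ d ∈ A, ¬ q ∣ d - a := by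
    by_contra! h
    exact h2 (by simpa using (h c hc).sub (h c' hc'))
  have hpd : p ∣ d - a := (hne d hd a ha).resolve_right hd'
  rcases hne d hd a' ha' with h | h
  · exact h1 (by simpa using h.sub hpd)
  · exact hd' (by simpa using h.sub hq')

/-- If the period has only the prime factors `p` and `q`, then one of the tiles is contained in a
single residue class modulo `p` or `q`. -/
theorem TilesMod.dvd_sub {n : ℕ} [NeZero n] {A B : Finset ℤ} (h : TilesMod n A B) {p q : ℕ}
    (hp : p.Prime) (hn : n.primeFactors ⊆ {p, q}) :
    ∃ l ∈ ({p, q} : Finset ℕ), (∀ a ∈ A, ∀ a' ∈ A, (l : ℤ) ∣ a - a') ∨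
      ∀ b ∈ B, ∀ b' ∈ B, (l : ℤ) ∣ b - b' := by
  by_contra! hcon
  have hunit : ∀ x : ℤ, ¬ (p : ℤ) ∣ x → ¬ (q : ℤ) ∣ x → IsUnit (x : ZMod n) := by
    intro x hx hx'
    rw [ZMod.coe_int_isUnit_iff_isCoprime, Int.isCoprime_iff_gcd_eq_one]
    by_contra hg
    obtain ⟨r, hr, hrg⟩ := Nat.exists_prime_and_dvd hg
    have hrn : r ∣ n := by exact_mod_cast hrg.trans (Int.gcd_dvd_natAbs_left _ _)
    have hrx : (r : ℤ) ∣ x := Int.natCast_dvd.2 (hrg.trans (Int.gcd_dvd_natAbs_right _ _))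
    have := hn (Nat.mem_primeFactors.2 ⟨hr, hrn, NeZero.ne n⟩)
    simp only [Finset.mem_insert, Finset.mem_singleton] at this
    rcases this with rfl | rfl
    · exact hx hrx
    · exact hx' hrx
  have hP := hcon p (by simp)
  have hQ := hcon q (by simp)
  obtain ⟨a, ha, a', ha', h1, h2⟩ := Int.exists_pair_not_dvd_sub hP.1 hQ.1
  obtain ⟨b, hb, b', hb', h3, h4⟩ := Int.exists_pair_not_dvd_sub hP.2 hQ.2
  exact h.not_isUnit_sub ha ha' hb hb' (fun e => h1 (by simp [e])) (hunit _ h1 h2) (hunit _ h3 h4)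

/-! ### From tilings of the integers to tilings of `ℤ / n`. -/

/-- A complement of a finite set of integers is eventually periodic to the right: membership of `x`
is determined by a window of fixed length to the left of `x`. -/
theorem exists_eventually_periodic {A : Finset ℤ} {C : Set ℤ}
    (h : ∀ x : ℤ, ∃ a ∈ A, ∃ c ∈ C, a + c = x)
    (h' : ∀ a ∈ A, ∀ a' ∈ A, ∀ c ∈ C, ∀ c' ∈ C, a + c = a' + c' → a = a' ∧ c = c') :
    ∃ n : ℕ, n ≠ 0 ∧ ∃ u : ℤ, ∀ x, u ≤ x → (x ∈ C ↔ x + n ∈ C) := by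
  obtain ⟨a₁, ha₁, -⟩ := h 0
  have hA : A.Nonempty := ⟨a₁, ha₁⟩
  set m := A.min' hA
  have hm : m ∈ A := A.min'_mem hA
  have hmin : ∀ a ∈ A, m ≤ a := fun a ha => A.min'_le a ha
  obtain ⟨L, hL⟩ : ∃ L : ℕ, ∀ a ∈ A, a - m ≤ L :=
    ⟨(A.max' hA - m).toNat, fun a ha => by have := A.le_max' a ha; omega⟩
  -- The point `x + m` is covered either by `m` and `x`, or by a larger `a` and an element of `C` in
  -- `[x - L, x)`.
  have hdet : ∀ x, x ∈ C ↔ ∀ a ∈ A, a ≠ m → x + m - a ∉ C := by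
    intro x
    constructor
    · intro hx a ha hne hc
      exact hne (h' a ha m hm _ hc x hx (by ring)).1
    · intro hx
      obtain ⟨a, ha, c, hc, e⟩ := h (x + m)
      by_cases hne : a = m
      · obtain rfl : c = x := by rw [hne] at e; omega
        exact hc
      · obtain rfl : c = x + m - a := by omega
        exact absurd hc (hx a ha hne)
  -- There are finitely many patterns on a window of length `L`, so one recurs; it then determines
  -- everything to its right.
  obtain ⟨i, j, hij, hw⟩ : ∃ i j : ℕ, i < j ∧ ∀ t : Fin L, ((i + t : ℤ) ∈ C ↔ (j + t : ℤ) ∈ C) := by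
    obtain ⟨i, j, hne, e⟩ := Finite.exists_ne_map_eq_of_infinite
      (fun (i : ℕ) (t : Fin L) => ((i + t : ℤ) ∈ C))
    have e' : ∀ t : Fin L, ((i + t : ℤ) ∈ C ↔ (j + t : ℤ) ∈ C) := fun t => by
      simpa using congrFun e t
    rcases lt_or_gt_of_ne hne with hlt | hlt
    · exact ⟨i, j, hlt, e'⟩
    · exact ⟨j, i, hlt, fun t => (e' t).symm⟩
  refine ⟨j - i, by omega, i, fun x hx => ?_⟩
  obtain ⟨t, rfl⟩ : ∃ t : ℕ, x = i + t := ⟨(x - i).toNat, by omega⟩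
  have key : ∀ t : ℕ, ((i + t : ℤ) ∈ C ↔ (j + t : ℤ) ∈ C) := by
    intro t
    induction t using Nat.strong_induction_on with
    | _ t ih =>
      by_cases ht : t < L
      · exact hw ⟨t, ht⟩
      · rw [hdet, hdet (j + t)]
        refine forall₃_congr fun a ha hne => not_congr ?_
        have h1 := hL a ha
        have h2 := hmin a ha
        obtain ⟨s, hs⟩ : ∃ s : ℕ, (s : ℤ) = t + m - a := ⟨(t + m - a).toNat, by omega⟩
        have := ih s (by omega)
        rw [hs] at this
        convert this using 2 <;> ring
  rw [key]
  have : (i + t + (j - i : ℕ) : ℤ) = j + t := by omega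
  rw [this]

/-- Periodicity to the right suffices: one period of `C` beyond `u` serves as `B`, because any
residue class has representatives far to the right. -/
theorem exists_tilesMod {A : Finset ℤ} {C : Set ℤ}
    (h : ∀ x : ℤ, ∃ a ∈ A, ∃ c ∈ C, a + c = x)
    (h' : ∀ a ∈ A, ∀ a' ∈ A, ∀ c ∈ C, ∀ c' ∈ C, a + c = a' + c' → a = a' ∧ c = c') :
    ∃ n : ℕ, n ≠ 0 ∧ ∃ B, TilesMod n A B := by
  classical
  obtain ⟨n, hn, u, hu⟩ := exists_eventually_periodic h h'
  have hn' : (0 : ℤ) < n := by exact_mod_cast Nat.pos_of_ne_zero hn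
  have hper : ∀ (k : ℕ) (x : ℤ), u ≤ x → (x ∈ C ↔ x + n * k ∈ C) := by
    intro k
    induction k with
    | zero => simp
    | succ k ih =>
      intro x hx
      rw [ih x hx, hu (x + n * k) (le_add_of_le_of_nonneg hx (by positivity))]
      push_cast
      ring_nf
  refine ⟨n, hn, {c ∈ Finset.Ico u (u + n) | c ∈ C}, ?_, ?_⟩
  · intro x
    obtain ⟨M, hM⟩ : ∃ M : ℤ, ∀ a ∈ A, a ≤ M := by
      obtain ⟨M, hM⟩ := A.bddAbove
      exact ⟨M, fun a ha => hM ha⟩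
    -- The shift is a multiple of `n` large enough to force `u ≤ c`.
    obtain ⟨a, ha, c, hc, e⟩ := h (x + n * |M + u - x|)
    have huc : u ≤ c := by
      have h1 := hM a ha
      have h2 := le_abs_self (M + u - x)
      have h3 : |M + u - x| ≤ n * |M + u - x| := le_mul_of_one_le_left (abs_nonneg _) hn'
      omega
    have hlt := Int.emod_lt_of_pos (c - u) hn'
    have hnn := Int.emod_nonneg (c - u) hn'.ne'
    have hdm := Int.mul_ediv_add_emod (c - u) n
    obtain ⟨k, hk⟩ := Int.eq_ofNat_of_zero_le (Int.ediv_nonneg (sub_nonneg.2 huc) hn'.le)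
    rw [hk] at hdm
    refine ⟨a, ha, u + (c - u) % n, ?_, ?_⟩
    · rw [Finset.mem_filter, Finset.mem_Ico]
      refine ⟨⟨by omega, by omega⟩, (hper k _ (by omega)).2 ?_⟩
      convert hc using 1
      linarith
    · rw [Int.modEq_iff_dvd]
      exact ⟨k - |M + u - x|, by linear_combination -e - hdm⟩
  · have aux : ∀ a ∈ A, ∀ a' ∈ A, ∀ b ∈ {c ∈ Finset.Ico u (u + n) | c ∈ C},
        ∀ b' ∈ {c ∈ Finset.Ico u (u + n) | c ∈ C}, ∀ k : ℕ, a' + b' - (a + b) = n * k →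
        a = a' ∧ b = b' := by
      intro a ha a' ha' b hb b' hb' k e
      rw [Finset.mem_filter, Finset.mem_Ico] at hb hb'
      have hbk := (hper k b hb.1.1).1 hb.2
      obtain ⟨h1, h2⟩ := h' a ha a' ha' _ hbk b' hb'.2 (by linarith)
      obtain rfl | hk := Nat.eq_zero_or_pos k
      · exact ⟨h1, by simpa using h2⟩
      · have : (n : ℤ) * 1 ≤ n * k := by gcongr; exact_mod_cast hk
        omega
    intro a ha a' ha' b hb b' hb' e
    obtain ⟨k, hk⟩ := Int.modEq_iff_dvd.1 e
    obtain ⟨k, rfl | rfl⟩ := Int.eq_nat_or_neg k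
    · exact aux a ha a' ha' b hb b' hb' k hk
    · obtain ⟨h1, h2⟩ := aux a' ha' a ha b' hb' b hb k (by linarith)
      exact ⟨h1.symm, h2.symm⟩

/-! ### Exponential sums and cyclotomic divisors. -/

/-- The exponential sum `∑_{a ∈ A} ζ ^ a`. -/
noncomputable def expSum (A : Finset ℤ) (ζ : ℂ) : ℂ := ∑ a ∈ A, ζ ^ a

/-- The generating function of `A` vanishes at all primitive `s`-th roots of unity. -/
def VanishesAt (A : Finset ℤ) (s : ℕ) : Prop := ∀ ζ : ℂ, IsPrimitiveRoot ζ s → expSum A ζ = 0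

theorem cyclotomic_dvd_iff_aeval_eq_zero {s : ℕ} (hs : 0 < s) {ζ : ℂ} (hζ : IsPrimitiveRoot ζ s)
    (f : Polynomial ℤ) : Polynomial.cyclotomic s ℤ ∣ f ↔ Polynomial.aeval ζ f = 0 := by
  rw [Polynomial.cyclotomic_eq_minpoly hζ hs,
    minpoly.isIntegrallyClosed_dvd_iff (hζ.isIntegral hs)]

theorem cyclotomic_dvd_setPoly_iff {s : ℕ} (hs : 0 < s) (A : Finset ℕ) :
    Polynomial.cyclotomic s ℤ ∣ setPoly A ↔ VanishesAt (A.image Nat.cast) s := by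
  have key : ∀ ζ : ℂ, Polynomial.aeval ζ (setPoly A) = expSum (A.image Nat.cast) ζ := fun ζ => by
    rw [expSum, Finset.sum_image (by simp)]
    simp [setPoly]
  refine ⟨fun h ζ hζ => ?_, fun h => ?_⟩
  · rw [← key, ← cyclotomic_dvd_iff_aeval_eq_zero hs hζ]
    exact h
  · have hζ := Complex.isPrimitiveRoot_exp s hs.ne'
    rw [cyclotomic_dvd_iff_aeval_eq_zero hs hζ, key]
    exact h _ hζ

/-- After a translation, an exponential sum is the value of an integer polynomial. -/
theorem exists_aeval_eq_expSum (A : Finset ℤ) : ∃ (f : Polynomial ℤ) (t : ℤ),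
    f.eval 1 = A.card ∧ ∀ ζ : ℂ, ζ ≠ 0 → Polynomial.aeval ζ f = ζ ^ t * expSum A ζ := by
  obtain ⟨m, hm⟩ := A.bddBelow
  refine ⟨∑ a ∈ A, Polynomial.X ^ (a - m).toNat, -m, ?_, fun ζ hζ => ?_⟩
  · simp [Polynomial.eval_finsetSum]
  · simp only [map_sum, map_pow, Polynomial.aeval_X, expSum, Finset.mul_sum]
    refine Finset.sum_congr rfl fun a ha => ?_
    have : m ≤ a := hm ha
    rw [← zpow_natCast, ← zpow_add₀ hζ, Int.toNat_of_nonneg (by omega)]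
    congr 1
    ring

/-- Translation only introduces a nonzero factor `ζ ^ t`, so a single `f` serves every `s`, and one
primitive root decides for all. -/
theorem exists_cyclotomic_dvd_iff_vanishesAt (A : Finset ℤ) : ∃ f : Polynomial ℤ,
    f.eval 1 = A.card ∧ ∀ s : ℕ, 0 < s →
      (VanishesAt A s ↔ Polynomial.cyclotomic s ℤ ∣ f) ∧
      ∀ ζ : ℂ, IsPrimitiveRoot ζ s → expSum A ζ = 0 → Polynomial.cyclotomic s ℤ ∣ f := by
  obtain ⟨f, t, h1, hf⟩ := exists_aeval_eq_expSum A
  have key : ∀ s : ℕ, 0 < s → ∀ ζ : ℂ, IsPrimitiveRoot ζ s →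
      (expSum A ζ = 0 ↔ Polynomial.cyclotomic s ℤ ∣ f) := fun s hs ζ hζ => by
    have h0 : ζ ≠ 0 := hζ.ne_zero hs.ne'
    rw [cyclotomic_dvd_iff_aeval_eq_zero hs hζ, hf ζ h0, mul_eq_zero,
      or_iff_right (zpow_ne_zero t h0)]
  refine ⟨f, h1, fun s hs => ⟨⟨fun h => ?_, fun h ζ hζ => (key s hs ζ hζ).2 h⟩,
    fun ζ hζ => (key s hs ζ hζ).1⟩⟩
  have hζ := Complex.isPrimitiveRoot_exp s hs.ne'
  exact (key s hs _ hζ).1 (h _ hζ)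

theorem VanishesAt.of_root {A : Finset ℤ} {s : ℕ} (hs : 0 < s) {ζ : ℂ} (hζ : IsPrimitiveRoot ζ s)
    (h : expSum A ζ = 0) : VanishesAt A s := by
  obtain ⟨f, -, hf⟩ := exists_cyclotomic_dvd_iff_vanishesAt A
  exact (hf s hs).1.2 ((hf s hs).2 ζ hζ h)

/-- The distinct irreducible factors `Φ_{p^(k+1)}` have a product dividing `f`. Each takes the value
`p` at `1`, where `f` takes the value `#A`. -/
theorem pow_card_dvd_card {A : Finset ℤ} {p : ℕ} (hp : p.Prime) (K : Finset ℕ)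
    (hK : ∀ k ∈ K, VanishesAt A (p ^ (k + 1))) : p ^ K.card ∣ A.card := by
  obtain ⟨f, h1, hf⟩ := exists_cyclotomic_dvd_iff_vanishesAt A
  have := Fact.mk hp
  have hpos : ∀ k : ℕ, 0 < p ^ (k + 1) := fun k => pow_pos hp.pos _
  have hd : ∏ k ∈ K, Polynomial.cyclotomic (p ^ (k + 1)) ℤ ∣ f := by
    refine Finset.prod_dvd_of_isRelPrime (fun i _ j _ hij => ?_)
      fun k hk => (hf _ (hpos k)).1.1 (hK k hk)
    rw [Function.onFun,
      (Polynomial.cyclotomic.irreducible (hpos i)).isRelPrime_iff_not_dvd]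
    intro hdvd
    have ha := (Polynomial.cyclotomic.irreducible (hpos i)).associated_of_dvd
      (Polynomial.cyclotomic.irreducible (hpos j)) hdvd
    have he := Polynomial.eq_of_monic_of_associated (Polynomial.cyclotomic.monic _ _)
      (Polynomial.cyclotomic.monic _ _) ha
    have := Nat.pow_right_injective hp.two_le (Polynomial.cyclotomic_injective he)
    omega
  have he := Polynomial.eval_dvd (x := (1 : ℤ)) hd
  rw [h1, Polynomial.eval_prod] at he
  simp only [Polynomial.eval_one_cyclotomic_prime_pow, Finset.prod_const] at he
  exact_mod_cast he

theorem VanishesAt.prime_dvd_card {A : Finset ℤ} {p k : ℕ} (hp : p.Prime)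
    (h : VanishesAt A (p ^ (k + 1))) : p ∣ A.card := by
  simpa using pow_card_dvd_card hp {k} (by simpa using h)

namespace TilesMod

variable {n : ℕ} {A B : Finset ℤ}

/-- By the tiling, the product is the full geometric sum over `ℤ / n`. -/
theorem expSum_mul_expSum [NeZero n] (h : TilesMod n A B) {ζ : ℂ} (h1 : ζ ^ n = 1) (hζ : ζ ≠ 1) :
    expSum A ζ * expSum B ζ = 0 := by
  have h0 : ζ ≠ 0 := by
    rintro rfl
    simp [NeZero.ne n] at h1
  have hmod : ∀ x : ℤ, ζ ^ ((x : ZMod n).val) = ζ ^ x := fun x => by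
    rw [← zpow_natCast, ZMod.val_intCast]
    nth_rw 2 [← Int.mul_ediv_add_emod x n]
    rw [zpow_add₀ h0, zpow_mul, zpow_natCast, h1, one_zpow, one_mul]
  have h2 := h.sum_eq (fun y => ζ ^ y.val)
  simp only [hmod] at h2
  have h3 : ∑ y : ZMod n, ζ ^ y.val = ∑ i ∈ Finset.range n, ζ ^ i :=
    Finset.sum_bij (fun y _ => y.val) (fun y _ => Finset.mem_range.2 y.val_lt)
      (fun _ _ _ _ e => ZMod.val_injective n e)
      (fun i hi => ⟨i, Finset.mem_univ _, ZMod.val_cast_of_lt (Finset.mem_range.1 hi)⟩)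
      (fun _ _ => rfl)
  have h4 : ∑ i ∈ Finset.range n, ζ ^ i = 0 := by
    have := mul_geom_sum ζ n
    rw [h1, sub_self] at this
    exact (mul_eq_zero.1 this).resolve_left (sub_ne_zero.2 hζ)
  rw [h3, h4, Finset.sum_product] at h2
  rw [expSum, expSum, Finset.sum_mul_sum, ← h2]
  simp only [zpow_add₀ h0]

theorem vanishesAt_or [NeZero n] (h : TilesMod n A B) {s : ℕ} (hs : 1 < s) (hsn : s ∣ n) :
    VanishesAt A s ∨ VanishesAt B s := by
  have hs0 : 0 < s := by omega
  have hζ := Complex.isPrimitiveRoot_exp s hs0.ne'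
  rcases mul_eq_zero.1 (h.expSum_mul_expSum ((hζ.pow_eq_one_iff_dvd n).2 hsn) (hζ.ne_one hs)) with
    h | h
  · exact Or.inl (.of_root hs0 hζ h)
  · exact Or.inr (.of_root hs0 hζ h)

/-- Counting the prime powers at which the two tiles vanish. -/
theorem not_vanishesAt_and_dvd [NeZero n] (h : TilesMod n A B) {p k : ℕ} (hp : p.Prime)
    (hA : VanishesAt A (p ^ (k + 1))) : ¬ VanishesAt B (p ^ (k + 1)) ∧ p ^ (k + 1) ∣ n := by
  classical
  have hn := NeZero.ne n
  set v := n.factorization p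
  -- `#A * #B = n` leaves room for only `v` vanishings at powers of `p`. The `v` powers dividing `n`
  -- already use them all, so no further one can occur.
  have hcount : ∀ K L : Finset ℕ, (∀ i ∈ K, VanishesAt A (p ^ (i + 1))) →
      (∀ i ∈ L, VanishesAt B (p ^ (i + 1))) → K.card + L.card ≤ v := by
    intro K L hK hL
    rw [← hp.pow_dvd_iff_le_factorization hn, pow_add, ← h.card_mul_card]
    exact mul_dvd_mul (pow_card_dvd_card hp K hK) (pow_card_dvd_card hp L hL)
  have hdvd : ∀ i : ℕ, p ^ i ∣ n ↔ i ≤ v := fun i => hp.pow_dvd_iff_le_factorization hn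
  set K := {i ∈ Finset.range v | VanishesAt A (p ^ (i + 1))}
  set L := {i ∈ Finset.range v | ¬ VanishesAt A (p ^ (i + 1))}
  have hKL : K.card + L.card = v := by
    simpa using Finset.card_filter_add_card_filter_not (s := Finset.range v)
      (fun i => VanishesAt A (p ^ (i + 1)))
  have hK : ∀ i ∈ K, VanishesAt A (p ^ (i + 1)) := fun i hi => (Finset.mem_filter.1 hi).2
  have hL : ∀ i ∈ L, VanishesAt B (p ^ (i + 1)) := fun i hi => by
    obtain ⟨h1, h2⟩ := Finset.mem_filter.1 hi
    exact (h.vanishesAt_or (Nat.one_lt_pow (by omega) hp.one_lt)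
      ((hdvd _).2 (Finset.mem_range.1 h1))).resolve_left h2
  constructor
  · intro hB
    have hkL : k ∉ L := fun hk => (Finset.mem_filter.1 hk).2 hA
    have := hcount K (insert k L) hK (by simpa [hB] using hL)
    rw [Finset.card_insert_of_notMem hkL] at this
    omega
  · rw [hdvd]
    by_contra hlt
    have hkK : k ∉ K := fun hk => hlt (Finset.mem_range.1 (Finset.mem_filter.1 hk).1)
    have := hcount (insert k K) L (by simpa [hA] using hK) hL
    rw [Finset.card_insert_of_notMem hkK] at this
    omega

end TilesMod

/-! ### Exponential sums of residue fibres. -/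

theorem expSum_eq_sum_residueFiber (A : Finset ℤ) {r : ℕ} (hr : 0 < r) {ζ : ℂ} (hζ : ζ ≠ 0) :
    expSum A ζ = ∑ j ∈ Finset.Ico (0 : ℤ) r, ζ ^ j * expSum (residueFiber A r j) (ζ ^ r) := by
  have hr' : (0 : ℤ) < r := by exact_mod_cast hr
  rw [expSum, ← Finset.sum_fiberwise_of_maps_to (t := Finset.Ico (0 : ℤ) r) (g := (· % (r : ℤ)))
    fun a _ => Finset.mem_Ico.2 ⟨Int.emod_nonneg _ hr'.ne', Int.emod_lt_of_pos _ hr'⟩]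
  refine Finset.sum_congr rfl fun j _ => ?_
  rw [residueFiber, expSum, Finset.sum_image, Finset.mul_sum]
  · refine Finset.sum_congr rfl fun a ha => ?_
    rw [← (Finset.mem_filter.1 ha).2, ← zpow_natCast, ← zpow_mul, ← zpow_add₀ hζ, add_comm,
      Int.mul_ediv_add_emod]
  · intro a ha b hb e
    rw [← Int.mul_ediv_add_emod a r, ← Int.mul_ediv_add_emod b r, (Finset.mem_filter.1 ha).2,
      (Finset.mem_filter.1 hb).2]
    simp only at e
    rw [e]

theorem expSum_eq_of_emod_eq {A : Finset ℤ} {r : ℕ} (hr : 0 < r) {k : ℤ}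
    (hA : ∀ a ∈ A, a % r = k) {ζ : ℂ} (hζ : ζ ≠ 0) :
    expSum A ζ = ζ ^ k * expSum (residueFiber A r k) (ζ ^ r) := by
  rcases A.eq_empty_or_nonempty with rfl | ⟨a₀, ha₀⟩
  · simp [expSum, residueFiber]
  have hr' : (0 : ℤ) < r := by exact_mod_cast hr
  rw [expSum_eq_sum_residueFiber A hr hζ, Finset.sum_eq_single k]
  · intro j _ hjk
    have : residueFiber A r j = ∅ := by
      rw [residueFiber, Finset.filter_eq_empty_iff.2, Finset.image_empty]
      intro a ha e
      exact hjk (by rw [← e, hA a ha])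
    simp [this, expSum]
  · intro hk
    exact absurd (Finset.mem_Ico.2 (hA _ ha₀ ▸
      ⟨Int.emod_nonneg _ hr'.ne', Int.emod_lt_of_pos _ hr'⟩)) hk

theorem expSum_one (A : Finset ℤ) : expSum A 1 = A.card := by simp [expSum]

theorem Int.exists_emod_eq_of_dvd_sub {A : Finset ℤ} {l : ℤ}
    (h : ∀ a ∈ A, ∀ a' ∈ A, l ∣ a - a') : ∃ k, ∀ a ∈ A, a % l = k := by
  rcases A.eq_empty_or_nonempty with rfl | ⟨a₀, ha₀⟩
  · exact ⟨0, by simp⟩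
  · exact ⟨a₀ % l, fun a ha => (Int.emod_eq_emod_iff_emod_sub_eq_zero.2 (Int.emod_eq_zero_of_dvd (h a ha a₀ ha₀)))⟩

/-- `hpow` covers both situations needed later: `s = r * t`, and `t = s` coprime to `r`. -/
theorem VanishesAt.of_residueFiber {B : Finset ℤ} {r s t : ℕ} {k : ℤ} (hr : 0 < r) (hs : s ≠ 0)
    (hB : ∀ b ∈ B, b % r = k)
    (hpow : ∀ ζ : ℂ, IsPrimitiveRoot ζ s → IsPrimitiveRoot (ζ ^ r) t)
    (h : VanishesAt (residueFiber B r k) t) : VanishesAt B s := fun ζ hζ => by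
  rw [expSum_eq_of_emod_eq hr hB (hζ.ne_zero hs), h _ (hpow ζ hζ), mul_zero]

theorem VanishesAt.residueFiber {A : Finset ℤ} {r s t : ℕ} {k : ℤ} (hr : 0 < r) (hs : s ≠ 0)
    (ht : 0 < t) (hA : ∀ a ∈ A, a % r = k)
    (hpow : ∀ ζ : ℂ, IsPrimitiveRoot ζ s → IsPrimitiveRoot (ζ ^ r) t)
    (h : VanishesAt A s) : VanishesAt (residueFiber A r k) t := by
  have hζ := Complex.isPrimitiveRoot_exp s hs
  have h0 := h _ hζ
  rw [expSum_eq_of_emod_eq hr hA (hζ.ne_zero hs)] at h0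
  exact .of_root ht (hpow _ hζ)
    ((mul_eq_zero.1 h0).resolve_left (zpow_ne_zero _ (hζ.ne_zero hs)))

theorem not_vanishesAt_one {A : Finset ℤ} (hA : A.Nonempty) : ¬ VanishesAt A 1 := fun h => by
  have := h 1 IsPrimitiveRoot.one
  rw [expSum_one] at this
  exact hA.card_ne_zero (by exact_mod_cast this)

/-! ### Induction on the period. -/

namespace TilesMod

theorem nonempty {n : ℕ} {A B : Finset ℤ} (h : TilesMod n A B) : A.Nonempty := by
  obtain ⟨a, ha, -⟩ := h.exists_modEq 0
  exact ⟨a, ha⟩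

section

variable {p q m i j : ℕ} {A B : Finset ℤ} {k : ℤ}

theorem isPrimitiveRoot_pow_of_mul {ζ : ℂ} (hp : p.Prime) {s : ℕ} (hs : s ≠ 0)
    (hζ : IsPrimitiveRoot ζ (p * s)) : IsPrimitiveRoot (ζ ^ p) s :=
  hζ.pow (Nat.mul_pos hp.pos (Nat.pos_of_ne_zero hs)) rfl

/-- Here `A = p A' + k`, so vanishing at `p ^ (i + 1)` becomes vanishing of `A'` at `p ^ i`, and `q
^ (j + 1)` is unaffected. The case `i = 0` is impossible because `A'` is nonempty. -/
theorem vanishesAt_of_left_emod_eq (hp : p.Prime) (hq : q.Prime) (hpq : p ≠ q)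
    (ih : ∀ (A B : Finset ℤ) (i : ℕ), TilesMod m A B → VanishesAt A (p ^ (i + 1)) →
      VanishesAt A (q ^ (j + 1)) → VanishesAt A (p ^ (i + 1) * q ^ (j + 1)))
    (h : TilesMod (p * m) A B) (hA : ∀ a ∈ A, a % p = k)
    (hAp : VanishesAt A (p ^ (i + 1))) (hAq : VanishesAt A (q ^ (j + 1))) :
    VanishesAt A (p ^ (i + 1) * q ^ (j + 1)) := by
  have hcop : p.Coprime (q ^ (j + 1)) := Nat.Coprime.pow_right _ ((Nat.coprime_primes hp hq).2 hpq)
  have hp0 : ∀ i, p ^ i ≠ 0 := fun i => pow_ne_zero _ hp.ne_zero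
  have hq0 : q ^ (j + 1) ≠ 0 := pow_ne_zero _ hq.ne_zero
  have hA' := (h.symm.residueFiber hp.pos hA le_rfl (by exact_mod_cast hp.pos)).symm
  have h1 : VanishesAt (_root_.residueFiber A p k) (p ^ i) :=
    hAp.residueFiber hp.pos (hp0 _) (Nat.pos_of_ne_zero (hp0 _)) hA fun ζ hζ =>
      isPrimitiveRoot_pow_of_mul hp (hp0 i) (by rwa [← pow_succ'])
  have h2 : VanishesAt (_root_.residueFiber A p k) (q ^ (j + 1)) :=
    hAq.residueFiber hp.pos hq0 (Nat.pos_of_ne_zero hq0) hA fun ζ hζ =>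
      hζ.pow_of_coprime _ hcop
  obtain _ | i := i
  · exact absurd h1 (not_vanishesAt_one hA'.nonempty)
  · refine .of_residueFiber hp.pos (mul_ne_zero (hp0 _) hq0) hA (fun ζ hζ => ?_)
      (ih _ _ _ hA' h1 h2)
    exact isPrimitiveRoot_pow_of_mul hp (mul_ne_zero (hp0 _) hq0)
      (by rwa [← mul_assoc, ← pow_succ'])

/-- By counting, `B` vanishes at neither prime power, hence its fibre does not vanish at `p ^ i`
(for `i > 0`) or `q ^ (j + 1)`. So every fibre of `A` must, and by induction each summand of the
fibre decomposition is zero. For `i = 0`, vanishing at `q ^ (j + 1)` is already enough. -/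
theorem vanishesAt_of_right_emod_eq (hp : p.Prime) (hq : q.Prime) (hpq : p ≠ q) [NeZero m]
    (ih : ∀ (A B : Finset ℤ) (i : ℕ), TilesMod m A B → VanishesAt A (p ^ (i + 1)) →
      VanishesAt A (q ^ (j + 1)) → VanishesAt A (p ^ (i + 1) * q ^ (j + 1)))
    (h : TilesMod (p * m) A B) (hB : ∀ b ∈ B, b % p = k)
    (hAp : VanishesAt A (p ^ (i + 1))) (hAq : VanishesAt A (q ^ (j + 1))) :
    VanishesAt A (p ^ (i + 1) * q ^ (j + 1)) := by
  have hcop : p.Coprime (q ^ (j + 1)) := Nat.Coprime.pow_right _ ((Nat.coprime_primes hp hq).2 hpq)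
  have hp0 : ∀ i, p ^ i ≠ 0 := fun i => pow_ne_zero _ hp.ne_zero
  have hq0 : q ^ (j + 1) ≠ 0 := pow_ne_zero _ hq.ne_zero
  have : NeZero (p * m) := ⟨mul_ne_zero hp.ne_zero (NeZero.ne m)⟩
  obtain ⟨hBp, hpn⟩ := h.not_vanishesAt_and_dvd hp hAp
  obtain ⟨hBq, hqn⟩ := h.not_vanishesAt_and_dvd hq hAq
  intro ζ hζ
  have hζ0 := hζ.ne_zero (mul_ne_zero (hp0 _) hq0)
  rw [expSum_eq_sum_residueFiber A hp.pos hζ0]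
  refine Finset.sum_eq_zero fun t ht => mul_eq_zero_of_right _ ?_
  obtain ⟨ht0, htp⟩ := Finset.mem_Ico.1 ht
  have hA' := h.residueFiber hp.pos hB ht0 htp
  have h2 : VanishesAt (_root_.residueFiber A p t) (q ^ (j + 1)) :=
    (hA'.vanishesAt_or (Nat.one_lt_pow (by omega) hq.one_lt)
      (hcop.symm.dvd_of_dvd_mul_left hqn)).resolve_right fun h' =>
        hBq (.of_residueFiber hp.pos hq0 hB (fun ζ hζ => hζ.pow_of_coprime _ hcop) h')
  have hζp : IsPrimitiveRoot (ζ ^ p) (p ^ i * q ^ (j + 1)) :=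
    isPrimitiveRoot_pow_of_mul hp (mul_ne_zero (hp0 _) hq0) (by rwa [← mul_assoc, ← pow_succ'])
  obtain _ | i := i
  · exact h2 _ (by simpa using hζp)
  · refine ih _ _ _ hA' ?_ h2 _ hζp
    rw [pow_succ' p (i + 1)] at hpn
    refine (hA'.vanishesAt_or (Nat.one_lt_pow (by omega) hp.one_lt)
      (Nat.dvd_of_mul_dvd_mul_left hp.pos hpn)).resolve_right fun h' =>
        hBp (.of_residueFiber hp.pos (hp0 _) hB (fun ζ hζ => ?_) h')
    exact isPrimitiveRoot_pow_of_mul hp (hp0 _) (by rwa [← pow_succ'])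

end

/-- A tile of `ℤ / p ^ α q ^ β` vanishing at powers of `p` and of `q` vanishes at their product. -/
theorem vanishesAt_mul {n p q i j : ℕ} (hn : n ≠ 0) (hp : p.Prime) (hq : q.Prime) (hpq : p ≠ q)
    (hpf : n.primeFactors ⊆ {p, q}) {A B : Finset ℤ} (h : TilesMod n A B)
    (hAp : VanishesAt A (p ^ (i + 1))) (hAq : VanishesAt A (q ^ (j + 1))) :
    VanishesAt A (p ^ (i + 1) * q ^ (j + 1)) := by
  induction n using Nat.strong_induction_on generalizing A B i j with
  | _ n ih =>
    have := NeZero.mk hn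
    -- Both `p` and `q` divide `n`, so the period can be divided by whichever prime confines a tile.
    have hdvd : ∀ {r k : ℕ}, r.Prime → VanishesAt A (r ^ (k + 1)) → r ∣ n := fun hr hA =>
      (dvd_pow_self _ (by omega)).trans (h.not_vanishesAt_and_dvd hr hA).2
    have hlt : ∀ {r m : ℕ}, r.Prime → n = r * m → m ≠ 0 ∧ m < n ∧ m.primeFactors ⊆ {p, q} := by
      rintro r m hr rfl
      have hm : m ≠ 0 := right_ne_zero_of_mul hn
      exact ⟨hm, lt_mul_of_one_lt_left (Nat.pos_of_ne_zero hm) hr.one_lt,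
        (Nat.primeFactors_mono (Dvd.intro_left _ rfl) hn).trans hpf⟩
    obtain ⟨l, hl, hAB⟩ := h.dvd_sub hp hpf
    rw [Finset.mem_insert, Finset.mem_singleton] at hl
    rcases hl with rfl | rfl
    · obtain ⟨m, hm⟩ := hdvd hp hAp
      obtain ⟨hm0, hmn, hmpf⟩ := hlt hp hm
      have := NeZero.mk hm0
      subst hm
      have ih' := fun (A B : Finset ℤ) (i : ℕ) (h : TilesMod m A B) h1 h2 =>
        ih m hmn hm0 hmpf h (i := i) (j := j) h1 h2
      rcases hAB with hA | hB
      · obtain ⟨k, hk⟩ := Int.exists_emod_eq_of_dvd_sub hA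
        exact h.vanishesAt_of_left_emod_eq hp hq hpq ih' hk hAp hAq
      · obtain ⟨k, hk⟩ := Int.exists_emod_eq_of_dvd_sub hB
        exact h.vanishesAt_of_right_emod_eq hp hq hpq ih' hk hAp hAq
    · obtain ⟨m, hm⟩ := hdvd hq hAq
      obtain ⟨hm0, hmn, hmpf⟩ := hlt hq hm
      have := NeZero.mk hm0
      subst hm
      rw [mul_comm]
      have ih' : ∀ (A B : Finset ℤ) (j : ℕ), TilesMod m A B → VanishesAt A (l ^ (j + 1)) →
          VanishesAt A (p ^ (i + 1)) → VanishesAt A (l ^ (j + 1) * p ^ (i + 1)) :=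
        fun A B j h h1 h2 => by
          rw [mul_comm]
          exact ih m hmn hm0 hmpf h h2 h1
      rcases hAB with hA | hB
      · obtain ⟨k, hk⟩ := Int.exists_emod_eq_of_dvd_sub hA
        exact h.vanishesAt_of_left_emod_eq hq hp hpq.symm ih' hk hAq hAp
      · obtain ⟨k, hk⟩ := Int.exists_emod_eq_of_dvd_sub hB
        exact h.vanishesAt_of_right_emod_eq hq hp hpq.symm ih' hk hAq hAp

end TilesMod

/-! ### Conclusion. -/

theorem TilesIntegers.exists_tilesMod {A : Finset ℕ} (hA : TilesIntegers A) :
    ∃ n : ℕ, n ≠ 0 ∧ ∃ B, TilesMod n (A.image Nat.cast) B := by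
  obtain ⟨C, hC⟩ := hA
  rw [AddSubgroup.isComplement_iff_existsUnique] at hC
  refine _root_.exists_tilesMod (C := C) (fun x => ?_) fun a ha a' ha' c hc c' hc' e => ?_
  · obtain ⟨⟨⟨_, a, ha, rfl⟩, c, hc⟩, e, -⟩ := hC x
    exact ⟨a, Finset.mem_image_of_mem _ ha, c, hc, e⟩
  · obtain ⟨a, ha₀, rfl⟩ := Finset.mem_image.1 ha
    obtain ⟨a', ha₀', rfl⟩ := Finset.mem_image.1 ha'
    have := (hC (a + c)).unique (y₁ := (⟨a, a, ha₀, rfl⟩, ⟨c, hc⟩))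
      (y₂ := (⟨a', a', ha₀', rfl⟩, ⟨c', hc'⟩)) rfl e.symm
    exact ⟨congrArg (fun x => (x.1 : ℤ)) this, congrArg (fun x => (x.2 : ℤ)) this⟩

theorem theoremB2 (A : Finset ℕ) (hA : TilesIntegers A) (hcard : A.card.primeFactors.card ≤ 2) :
    SatisfiesT2 A := by
  intro m hm s hs ⟨p, hpinj, hp⟩
  have hcardim : (A.image (Nat.cast : ℕ → ℤ)).card = A.card :=
    Finset.card_image_of_injective _ Nat.cast_injective
  have hk : ∀ i, ∃ k, s i = p i ^ (k + 1) := fun i => by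
    obtain ⟨-, k, e⟩ := hp i
    obtain _ | k := k
    · exact absurd ((hs i).1.one_lt) (by simp [e])
    · exact ⟨k, e⟩
  choose k hk using hk
  have hv : ∀ i, VanishesAt (A.image Nat.cast) (p i ^ (k i + 1)) := fun i => by
    rw [← hk, ← cyclotomic_dvd_setPoly_iff (hs i).1.pos]
    exact (hs i).2
  obtain ⟨n, hn, B, hB⟩ := hA.exists_tilesMod
  have hA0 : A.card ≠ 0 := by
    rw [← hcardim]
    exact hB.nonempty.card_ne_zero
  have hmem : ∀ i, p i ∈ A.card.primeFactors := fun i =>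
    Nat.mem_primeFactors.2 ⟨(hp i).1, hcardim ▸ (hv i).prime_dvd_card (hp i).1, hA0⟩
  -- Each `p i` divides `#A`, so the distinct primes number at most two, and two of them exhaust the
  -- prime factors of `#A`.
  have hm2 : m ≤ 2 := by
    have := Finset.card_le_card_of_injOn (s := Finset.univ) p (fun i _ => hmem i) hpinj.injOn
    rw [Finset.card_fin] at this
    omega
  obtain rfl | rfl : m = 1 ∨ m = 2 := by omega
  · simpa using (hs 0).2
  · obtain ⟨n', hn', hpf, B', hB'⟩ := hB.exists_primeFactors_subset hn
    have hne : p 0 ≠ p 1 := fun e => by simpa using hpinj e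
    have hsub : A.card.primeFactors = {p 0, p 1} := by
      refine (Finset.eq_of_subset_of_card_le ?_ ?_).symm
      · simp [Finset.insert_subset_iff, hmem, -Nat.mem_primeFactors]
      · rwa [Finset.card_pair hne]
    rw [hcardim, hsub] at hpf
    rw [Fin.prod_univ_two, cyclotomic_dvd_setPoly_iff (Nat.mul_pos (hs 0).1.pos (hs 1).1.pos),
      hk, hk]
    exact hB'.vanishesAt_mul hn' (hp 0).1 (hp 1).1 hne hpf (hv 0) (hv 1)
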